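/- Let $D_1,\dots,D_n$ be independent random variables with values in $[0,1]$, with sum $D=\sum_{i=1}^n D_i$, and let $\kappa>0$ be a supply threshold. Put $$\delta=\mathbb{P}\Big(\bigcup_{i=1}^n\{D-D_i>\kappa\}\Big),\qquad \tau=\mathbb{E}\big[\min(D/\kappa,1)\big].$$ Then $$\tau\;\ge\;\frac{\frac1\kappa\ln\Big(\exp\Big(\kappa\sqrt{1-\exp\big(\tfrac1\kappa\ln\delta\big)}\Big)+(1-\delta)\Big)}{\exp\Big(\sqrt{1-\exp\big(\tfrac1\kappa\ln\delta\big)}-\tfrac1\kappa\ln\delta\Big)-1},$$ where for $\delta=0$ and $\delta=1$, in which case the right-hand side is not defined as written, it is understood as its limit as $\delta\downarrow0$, respectively $\delta\uparrow1$, namely $0$, respectively $1$. -/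

import Mathlib

open MeasureTheory ProbabilityTheory

/-- The total demand `D = ∑ i, D i`. -/
def totalDemand {Ω : Type*} {n : ℕ} (D : Fin n → Ω → ℝ) (ω : Ω) : ℝ :=
  ∑ i, D i ω

/-- The throughput `τ = 𝔼[min (D / κ, 1)]` of the demands for the supply threshold `κ`. -/
noncomputable def demandThroughput {Ω : Type*} [MeasurableSpace Ω] (P : Measure Ω) {n : ℕ}
    (D : Fin n → Ω → ℝ) (κ : ℝ) : ℝ :=
  ∫ ω, min (totalDemand D ω / κ) 1 ∂P

/-- The unavailability `δ = ℙ(⋃ i, {D - D i > κ})`. -/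
noncomputable def demandUnavailability {Ω : Type*} [MeasurableSpace Ω] (P : Measure Ω) {n : ℕ}
    (D : Fin n → Ω → ℝ) (κ : ℝ) : ℝ :=
  P.real (⋃ i, {ω | totalDemand D ω - D i ω > κ})

/-- The closed form bounding the throughput from below, meaningful for `0 < κ` and `0 < δ < 1`. -/
noncomputable def throughputClosedForm (κ δ : ℝ) : ℝ :=
  (1 / κ * Real.log
      (Real.exp (κ * Real.sqrt (1 - Real.exp (1 / κ * Real.log δ))) + (1 - δ))) /
    (Real.exp (Real.sqrt (1 - Real.exp (1 / κ * Real.log δ)) - 1 / κ * Real.log δ) - 1)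

/-! The truncated total `min D κ` has a Poisson-type moment generating function: `E exp(t min(D, κ))
≤ exp((exp t - 1) E min(D, κ))` for `t ≥ 0` (`poissonMGFBound_map_sum`, by induction on the summands
via `PoissonMGFBound.map_add`). Conversely the left side is at least `1 + δ (exp(κ t) - 1)`, as `D ≥
κ` on the unavailability event up to a null set. Taking logarithms bounds `κ τ = E min(D, κ)` below
for every `t > 0`; the closed form is this bound at one particular `t`. -/

/-- In `d` the left side is convex and the right side affine, so the endpoints suffice: `d = 0` is
the chord bound for `exp` on `[0, t]`, and `d = x` follows from `t ≤ exp t - 1`. -/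
theorem exp_mul_sub_le {t x d : ℝ} (hd : 0 ≤ d) (hdx : d ≤ x) (hx : x ≤ 1) :
    Real.exp (t * x - (Real.exp t - 1) * d) ≤ 1 + (Real.exp t - 1) * (x - d) := by
  set c := Real.exp t - 1 with hc
  have htc : t ≤ c := by linarith [Real.add_one_le_exp t]
  have hx0 : 0 ≤ x := hd.trans hdx
  have hexp : Real.exp (t * x) ≤ 1 + c * x := by
    have h := convexOn_exp.2 (Set.mem_univ 0) (Set.mem_univ t) (sub_nonneg.2 hx) hx0 (by ring)
    simp only [smul_eq_mul, mul_zero, zero_add, Real.exp_zero] at h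
    rw [mul_comm t x]
    linarith [mul_comm c x, show x * Real.exp t = x * c + x by rw [hc]; ring]
  rcases hx0.eq_or_lt with rfl | hx0
  · have : d = 0 := le_antisymm hdx hd
    simp [this]
  have hw : 0 ≤ (x - d) / x := div_nonneg (sub_nonneg.2 hdx) hx0.le
  have hw' : 0 ≤ d / x := div_nonneg hd hx0.le
  have hconv := convexOn_exp.2 (Set.mem_univ (t * x)) (Set.mem_univ (t * x - c * x)) hw hw'
    (by field_simp; ring)
  simp only [smul_eq_mul] at hconv
  have hone : Real.exp (t * x - c * x) ≤ 1 := by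
    rw [Real.exp_le_one_iff]; nlinarith
  have harg : (x - d) / x * (t * x) + d / x * (t * x - c * x) = t * x - c * d := by
    field_simp; ring
  rw [harg] at hconv
  have h1 : (x - d) / x * Real.exp (t * x) ≤ (x - d) / x * (1 + c * x) :=
    mul_le_mul_of_nonneg_left hexp hw
  have h2 : d / x * Real.exp (t * x - c * x) ≤ d / x * 1 :=
    mul_le_mul_of_nonneg_left hone hw'
  have h3 : (x - d) / x * (1 + c * x) + d / x * 1 = 1 + c * (x - d) := by
    field_simp; ring
  linarith

theorem integrable_min_const {Ω : Type*} [MeasurableSpace Ω] {P : Measure Ω} [IsFiniteMeasure P]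
    {Y : Ω → ℝ} (hY : Measurable Y) (hY0 : ∀ᵐ ω ∂P, 0 ≤ Y ω) {κ : ℝ} (hκ : 0 ≤ κ) :
    Integrable (fun ω => min (Y ω) κ) P := by
  refine Integrable.of_bound (hY.min measurable_const).aestronglyMeasurable κ ?_
  filter_upwards [hY0] with ω h
  rw [Real.norm_of_nonneg (le_min h hκ)]
  exact min_le_right _ _

theorem integrable_exp_mul_min_const {Ω : Type*} [MeasurableSpace Ω] {P : Measure Ω}
    [IsFiniteMeasure P] {Y : Ω → ℝ} (hY : Measurable Y) {t : ℝ} (ht : 0 ≤ t) (κ : ℝ) :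
    Integrable (fun ω => Real.exp (t * min (Y ω) κ)) P := by
  refine Integrable.of_bound (by fun_prop) (Real.exp (t * κ)) (ae_of_all _ fun ω => ?_)
  rw [Real.norm_of_nonneg (Real.exp_pos _).le, Real.exp_le_exp]
  exact mul_le_mul_of_nonneg_left (min_le_right _ _) ht

/-- Serve `x` first; `y` then faces the residual capacity. -/
theorem min_add_eq {x y κ : ℝ} (hy : 0 ≤ y) :
    min (x + y) κ = min x κ + min y (κ - min x κ) := by
  rcases le_total x κ with h | h
  · rw [min_eq_left h, ← min_add_add_left]; congr 1; ring
  · rw [min_eq_right h, min_eq_right (by linarith), sub_self, min_eq_right hy, add_zero]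

/-- The Poissonian bound on the moment generating function of a truncated variable. -/
def PoissonMGFBound (ν : Measure ℝ) (t : ℝ) : Prop :=
  ∀ κ, 0 ≤ κ → ∫ y, Real.exp (t * min y κ) ∂ν ≤
    Real.exp ((Real.exp t - 1) * ∫ y, min y κ ∂ν)

/-- Conditional step with the new summand frozen at `x`. The bound is affine in the conditional mean
of the truncated sum, so averaging over `x` loses nothing. -/
theorem PoissonMGFBound.integral_exp_le {ν : Measure ℝ} [IsProbabilityMeasure ν] {t : ℝ}
    (hν : PoissonMGFBound ν t) (hν0 : ∀ᵐ y ∂ν, 0 ≤ y) {κ : ℝ} (hκ : 0 ≤ κ) {x : ℝ}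
    (hx : x ∈ Set.Icc (0 : ℝ) 1) :
    ∫ y, Real.exp (t * min (x + y) κ) ∂ν ≤ Real.exp ((Real.exp t - 1) * ∫ y, min y κ ∂ν) *
      (1 + (Real.exp t - 1) * ((∫ y, min (x + y) κ ∂ν) - ∫ y, min y κ ∂ν)) := by
  set c := Real.exp t - 1
  set z := min x κ
  have hz0 : 0 ≤ z := le_min hx.1 hκ
  have hz1 : z ≤ 1 := (min_le_left _ _).trans hx.2
  have hzκ : 0 ≤ κ - z := sub_nonneg.2 (min_le_right _ _)
  have hI : ∀ {a : ℝ}, 0 ≤ a → Integrable (fun y => min y a) ν := fun ha =>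
    integrable_min_const measurable_id hν0 ha
  have hG : ∫ y, min (x + y) κ ∂ν = z + ∫ y, min y (κ - z) ∂ν := by
    rw [integral_congr_ae (hν0.mono fun y hy => min_add_eq (x := x) (κ := κ) hy),
      integral_add (integrable_const _) (hI hzκ)]
    simp [z]
  have hH : ∫ y, Real.exp (t * min (x + y) κ) ∂ν =
      Real.exp (t * z) * ∫ y, Real.exp (t * min y (κ - z)) ∂ν := by
    rw [← integral_const_mul]
    refine integral_congr_ae (hν0.mono fun y hy => ?_)
    simp only [min_add_eq (x := x) (κ := κ) hy, mul_add, Real.exp_add, z]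
  have hd0 : 0 ≤ (∫ y, min y κ ∂ν) - ∫ y, min y (κ - z) ∂ν :=
    sub_nonneg.2 (integral_mono (hI hzκ) (hI hκ) fun y => min_le_min_left _ (by linarith))
  have hdz : (∫ y, min y κ ∂ν) - ∫ y, min y (κ - z) ∂ν ≤ z := by
    have : ∫ y, min y κ ∂ν ≤ z + ∫ y, min y (κ - z) ∂ν := by
      rw [← hG]
      exact integral_mono_ae (hI hκ) (integrable_min_const (by fun_prop)
        (hν0.mono fun y hy => add_nonneg hx.1 hy) hκ)
        (ae_of_all _ fun y => min_le_min_right _ (by linarith [hx.1]))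
    linarith
  -- Here `d` is the drop in the truncated mean of `y` when `x` uses up capacity `z`.
  have key := exp_mul_sub_le (t := t) hd0 hdz hz1
  rw [hH, hG]
  calc _ ≤ Real.exp (t * z) * Real.exp (c * ∫ y, min y (κ - z) ∂ν) :=
        mul_le_mul_of_nonneg_left (hν _ hzκ) (Real.exp_pos _).le
    _ = Real.exp (c * ∫ y, min y κ ∂ν) *
        Real.exp (t * z - c * ((∫ y, min y κ ∂ν) - ∫ y, min y (κ - z) ∂ν)) := by
      rw [← Real.exp_add, ← Real.exp_add]; congr 1; ring
    _ ≤ _ := by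
      refine mul_le_mul_of_nonneg_left (key.trans_eq ?_) (Real.exp_pos _).le
      ring

theorem PoissonMGFBound.map_add {Ω : Type*} [MeasurableSpace Ω] {P : Measure Ω}
    [IsProbabilityMeasure P] {X Y : Ω → ℝ} (hX : Measurable X) (hY : Measurable Y)
    (hXY : IndepFun X Y P) (hX01 : ∀ᵐ ω ∂P, X ω ∈ Set.Icc (0 : ℝ) 1) (hY0 : ∀ᵐ ω ∂P, 0 ≤ Y ω)
    {t : ℝ} (ht : 0 ≤ t) (h : PoissonMGFBound (P.map Y) t) :
    PoissonMGFBound (P.map (X + Y)) t := by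
  intro κ hκ
  have : IsProbabilityMeasure (P.map X) := Measure.isProbabilityMeasure_map hX.aemeasurable
  have : IsProbabilityMeasure (P.map Y) := Measure.isProbabilityMeasure_map hY.aemeasurable
  set c := Real.exp t - 1
  have hprod := (indepFun_iff_map_prod_eq_prod_map_map hX.aemeasurable hY.aemeasurable).1 hXY
  have hν0 : ∀ᵐ y ∂(P.map Y), 0 ≤ y :=
    (ae_map_iff hY.aemeasurable measurableSet_Ici).2 hY0
  have hμ : ∀ᵐ x ∂(P.map X), x ∈ Set.Icc (0 : ℝ) 1 :=
    (ae_map_iff hX.aemeasurable measurableSet_Icc).2 hX01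
  have hpr : ∀ᵐ p ∂((P.map X).prod (P.map Y)), 0 ≤ p.1 + p.2 := by
    rw [← hprod, ae_map_iff (hX.prodMk hY).aemeasurable
      (measurableSet_le measurable_const (by fun_prop))]
    filter_upwards [hX01, hY0] with ω h1 h2 using add_nonneg h1.1 h2
  have hG := integrable_min_const (P := (P.map X).prod (P.map Y))
    (Y := fun p => p.1 + p.2) (by fun_prop) hpr hκ
  have hH := integrable_exp_mul_min_const (P := (P.map X).prod (P.map Y))
    (Y := fun p => p.1 + p.2) (by fun_prop) ht κ
  have hmap : ∀ f : ℝ → ℝ, Measurable f → ∫ y, f y ∂(P.map (X + Y)) =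
      ∫ p, f (p.1 + p.2) ∂((P.map X).prod (P.map Y)) := fun f hf => by
    rw [← hprod, integral_map (hX.add hY).aemeasurable hf.aestronglyMeasurable,
      integral_map (hX.prodMk hY).aemeasurable
        (show Measurable fun p : ℝ × ℝ => f (p.1 + p.2) from
          hf.comp (by fun_prop)).aestronglyMeasurable]
    rfl
  rw [hmap _ (by fun_prop), hmap _ (by fun_prop), integral_prod _ hG, integral_prod _ hH]
  set m := ∫ y, min y κ ∂(P.map Y)
  have hGi := hG.integral_prod_left
  have hGm : Integrable (fun x => (∫ y, min (x + y) κ ∂(P.map Y)) - m) (P.map X) :=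
    hGi.sub (integrable_const _)
  calc _ ≤ ∫ x, Real.exp (c * m) *
        (1 + c * ((∫ y, min (x + y) κ ∂(P.map Y)) - m)) ∂(P.map X) := by
        refine integral_mono_ae hH.integral_prod_left ?_
          (hμ.mono fun x hx => h.integral_exp_le hν0 hκ hx)
        exact ((integrable_const _).add (hGm.const_mul _)).const_mul _
    _ = Real.exp (c * m) *
        (1 + c * ((∫ x, ∫ y, min (x + y) κ ∂(P.map Y) ∂(P.map X)) - m)) := by
      rw [integral_const_mul, integral_add (integrable_const _)
        (hGm.const_mul _), integral_const_mul,
        integral_sub hGi (integrable_const _)]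
      simp
    _ ≤ _ := by
      -- After averaging, `1 + u ≤ exp u` turns the affine factor back into an exponential, and `m`
      -- cancels.
      have := Real.add_one_le_exp (c * ((∫ x, ∫ y, min (x + y) κ ∂(P.map Y) ∂(P.map X)) - m))
      calc _ ≤ Real.exp (c * m) *
            Real.exp (c * ((∫ x, ∫ y, min (x + y) κ ∂(P.map Y) ∂(P.map X)) - m)) :=
            mul_le_mul_of_nonneg_left (by linarith) (Real.exp_pos _).le
        _ = _ := by rw [← Real.exp_add]; congr 1; ring

theorem poissonMGFBound_map_sum {Ω ι : Type*} [MeasurableSpace Ω] {P : Measure Ω}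
    [IsProbabilityMeasure P] {D : ι → Ω → ℝ} (hmeas : ∀ i, Measurable (D i))
    (hD : ∀ i, ∀ᵐ ω ∂P, D i ω ∈ Set.Icc (0 : ℝ) 1) (hindep : iIndepFun D P) {t : ℝ} (ht : 0 ≤ t)
    (s : Finset ι) : PoissonMGFBound (P.map (∑ i ∈ s, D i)) t := by
  classical
  induction s using Finset.induction with
  | empty =>
    intro κ hκ
    simp only [Finset.sum_empty]
    rw [integral_map measurable_zero.aemeasurable (by fun_prop),
      integral_map measurable_zero.aemeasurable (by fun_prop)]
    simp [hκ]
  | insert i s hi ih =>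
    rw [Finset.sum_insert hi]
    refine PoissonMGFBound.map_add (Y := ∑ j ∈ s, D j) (hmeas i) (by fun_prop)
      (hindep.indepFun_finsetSum_of_notMem hmeas hi).symm (hD i) ?_ ht ih
    filter_upwards [s.eventually_all.2 fun j _ => hD j] with ω h
    rw [Finset.sum_apply]
    exact Finset.sum_nonneg fun j hj => (h j hj).1

/-- The integrand equals `exp(κ t)` where `Y ≥ κ` and is almost surely at least `1` elsewhere. -/
theorem one_add_measureReal_mul_le_integral_exp {Ω : Type*} [MeasurableSpace Ω] {P : Measure Ω}
    [IsProbabilityMeasure P] {Y : Ω → ℝ} (hY : Measurable Y) (hY0 : ∀ᵐ ω ∂P, 0 ≤ Y ω) {t κ : ℝ}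
    (ht : 0 ≤ t) (hκ : 0 ≤ κ) :
    1 + P.real {ω | κ ≤ Y ω} * (Real.exp (κ * t) - 1) ≤
      ∫ ω, Real.exp (t * min (Y ω) κ) ∂P := by
  have hs : MeasurableSet {ω | κ ≤ Y ω} := measurableSet_le measurable_const hY
  have hi : Integrable ({ω | κ ≤ Y ω}.indicator fun _ => Real.exp (κ * t) - 1) P :=
    (integrable_const _).indicator hs
  calc _ = ∫ ω, (1 + {ω | κ ≤ Y ω}.indicator (fun _ => Real.exp (κ * t) - 1) ω) ∂P := by
        rw [integral_add (integrable_const _) hi, integral_indicator_const _ hs]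
        simp
    _ ≤ _ := by
      refine integral_mono_ae ((integrable_const _).add hi)
        (integrable_exp_mul_min_const hY ht κ) ?_
      filter_upwards [hY0] with ω h
      by_cases hω : κ ≤ Y ω
      · simp [hω, mul_comm]
      · simp [hω, mul_nonneg ht (le_min h hκ)]

theorem throughputClosedForm_eq {κ δ : ℝ} (hκ : 0 < κ) (hδ : 0 < δ) {t : ℝ}
    (ht : t = Real.sqrt (1 - Real.exp (1 / κ * Real.log δ)) - 1 / κ * Real.log δ) :
    throughputClosedForm κ δ =
      1 / κ * Real.log (1 + δ * (Real.exp (κ * t) - 1)) / (Real.exp t - 1) := by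
  have : Real.exp (κ * Real.sqrt (1 - Real.exp (1 / κ * Real.log δ))) =
      δ * Real.exp (κ * t) := by
    -- The choice of `t` makes the square-root exponential equal to `δ * exp(κ t)`, so the
    -- logarithm's argument becomes `1 + δ (exp(κ t) - 1)`.
    have h : κ * Real.sqrt (1 - Real.exp (1 / κ * Real.log δ)) = Real.log δ + κ * t := by
      rw [ht]; field_simp; ring
    rw [h, Real.exp_add, Real.exp_log hδ]
  rw [throughputClosedForm, this, ← ht]
  congr 3
  ring

theorem mainTheorem4 {Ω : Type*} [MeasurableSpace Ω] (P : Measure Ω) [IsProbabilityMeasure P]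
    (n : ℕ) (D : Fin n → Ω → ℝ) (hmeas : ∀ i, Measurable (D i))
    (hD : ∀ i, ∀ᵐ ω ∂P, D i ω ∈ Set.Icc (0 : ℝ) 1) (hindep : iIndepFun D P)
    (κ : ℝ) (hκ : 0 < κ) (δ τ : ℝ)
    (hδ : δ = demandUnavailability P D κ) (hτ : τ = demandThroughput P D κ) :
    (0 < δ → δ < 1 → τ ≥ throughputClosedForm κ δ) ∧
      -- at the endpoints the closed form is read as its limit, `0` resp. `1`
      (δ = 0 → τ ≥ 0) ∧ (δ = 1 → τ ≥ 1) := by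
  have hY : Measurable (totalDemand D) := by unfold totalDemand; fun_prop
  have hall : ∀ᵐ ω ∂P, ∀ i, D i ω ∈ Set.Icc (0 : ℝ) 1 := ae_all_iff.2 hD
  have hY0 : ∀ᵐ ω ∂P, 0 ≤ totalDemand D ω :=
    hall.mono fun ω h => Finset.sum_nonneg fun i _ => (h i).1
  have hτ' : τ = 1 / κ * ∫ ω, min (totalDemand D ω) κ ∂P := by
    rw [hτ, demandThroughput, ← integral_const_mul]
    congr 1 with ω
    rw [mul_min_of_nonneg _ _ (by positivity : (0 : ℝ) ≤ 1 / κ), one_div_mul_cancel hκ.ne',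
      one_div_mul_eq_div]
  -- Since `D i ≥ 0` almost surely, `D - D i > κ` forces `D ≥ κ`.
  have hδle : δ ≤ P.real {ω | κ ≤ totalDemand D ω} := by
    rw [hδ, demandUnavailability]
    refine ENNReal.toReal_mono (measure_ne_top _ _) (measure_mono_ae ?_)
    filter_upwards [hall] with ω h hω
    obtain ⟨i, hi⟩ := Set.mem_iUnion.1 hω
    have hi : totalDemand D ω - D i ω > κ := hi
    change κ ≤ totalDemand D ω
    linarith [(h i).1]
  refine ⟨fun h0 h1 => ?_, fun _ => ?_, fun h1 => ?_⟩
  · obtain ⟨t, ht⟩ : ∃ t, t =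
        Real.sqrt (1 - Real.exp (1 / κ * Real.log δ)) - 1 / κ * Real.log δ := ⟨_, rfl⟩
    have ht0 : 0 < t := by
      have := mul_neg_of_pos_of_neg (one_div_pos.2 hκ) (Real.log_neg h0 h1)
      have := Real.sqrt_nonneg (1 - Real.exp (1 / κ * Real.log δ))
      linarith
    have hc : 0 < Real.exp t - 1 := by linarith [Real.one_lt_exp_iff.2 ht0]
    have hE : 0 ≤ Real.exp (κ * t) - 1 := by linarith [Real.one_le_exp (mul_pos hκ ht0).le]
    have hsum : (∑ i, D i) = totalDemand D := by ext ω; simp [totalDemand]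
    have hmgf := poissonMGFBound_map_sum hmeas hD hindep ht0.le Finset.univ κ hκ.le
    rw [hsum, integral_map hY.aemeasurable (by fun_prop),
      integral_map hY.aemeasurable (by fun_prop)] at hmgf
    have hlog : Real.log (1 + δ * (Real.exp (κ * t) - 1)) ≤
        (Real.exp t - 1) * ∫ ω, min (totalDemand D ω) κ ∂P := by
      rw [Real.log_le_iff_le_exp (by positivity)]
      refine le_trans ?_ ((one_add_measureReal_mul_le_integral_exp hY hY0 ht0.le hκ.le).trans hmgf)
      gcongr
    rw [throughputClosedForm_eq hκ h0 ht, hτ', ge_iff_le, div_le_iff₀ hc]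
    calc _ ≤ 1 / κ * ((Real.exp t - 1) * ∫ ω, min (totalDemand D ω) κ ∂P) :=
          mul_le_mul_of_nonneg_left hlog (by positivity)
      _ = _ := by ring
  · rw [hτ', ge_iff_le]
    exact mul_nonneg (by positivity)
      (integral_nonneg_of_ae (hY0.mono fun ω h => le_min h hκ.le))
  -- For `δ = 1` the total reaches `κ` almost surely, so the truncation is constant.
  · have hae : ∀ᵐ ω ∂P, κ ≤ totalDemand D ω := by
      have h := le_antisymm measureReal_le_one (h1 ▸ hδle)
      have := probReal_compl_eq_one_sub (μ := P) (measurableSet_le measurable_const hY :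
        MeasurableSet {ω | κ ≤ totalDemand D ω})
      rw [h, sub_self] at this
      rw [ae_iff]
      exact (measureReal_eq_zero_iff).1 this
    rw [hτ', integral_congr_ae (hae.mono fun ω h => min_eq_right h)]
    simp [hκ.ne']
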